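/- Let $(A,\oplus,\neg,0)$ be an MV-algebra, with $1:=\neg 0$, $a\ominus b:=\neg(\neg a\oplus b)$, and its underlying lattice order ($a\le b$ iff $\neg a\oplus b=1$). Let $Y$ be the set of prime MV-ideals of $A$, i.e. of proper subsets that contain $0$, are closed under $\oplus$ and downward closed, and contain $a\ominus b$ or $b\ominus a$ for all $a,b\in A$; write $I_y$ for the ideal that corresponds to $y\in Y$. Every prime MV-ideal is a prime ideal of the underlying lattice of $A$, so $Y$ is a subset of the set $X$ of prime lattice ideals of $A$. Let $\tau^{\uparrow}$ be the co-spectral topology on $Y$, i.e. the subspace topology from $X$, where $X$ has the sets $\{x\in X : a\in I_x\}$, $a\in A$, as a basis of open sets. Let $E:=\bigsqcup_{y\in Y}A/I_y$, let $p\colon E\to Y$ be the projection, and for $a\in A$ let $s_a\colon Y\to E$, $s_a(y):=[a]\in A/I_y$. Equip $E$ with the topology generated by the sets $s_a(U)$, for $a\in A$ and $U\in\tau^{\uparrow}$. Then $p\colon E\to (Y,\tau^{\uparrow})$ is a local homeomorphism (so $E$ is an étale space over $(Y,\tau^{\uparrow})$), and $a\mapsto s_a$ is an isomorphism of MV-algebras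 from $A$ onto the MV-algebra $\Gamma(E,p)$ of continuous global sections of $p$ with pointwise operations. Moreover, for each $y\in Y$, the stalk at $y$ of the sheaf of continuous sections of $p$ (the direct limit of the MV-algebras of sections over the open neighbourhoods of $y$) is isomorphic, by evaluation at $y$, to the quotient MV-algebra $A/I_y$, which is totally ordered. -/

import Mathlib

open TopologicalSpace Topology

universe u

/-- An MV-algebra `(A, ⊕, ¬, 0)`: a commutative monoid, written additively, so that `a + b` is
`a ⊕ b`, with a unary operation `aᶜ`, the MV-negation `¬a`. The element `1` is `0ᶜ`. -/
class MVAlgebra (A : Type u) extends AddCommMonoid A, Compl A where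
  compl_compl' : ∀ a : A, aᶜᶜ = a
  add_compl_zero' : ∀ a : A, a + (0 : A)ᶜ = (0 : A)ᶜ
  lukasiewicz : ∀ a b : A, (aᶜ + b)ᶜ + b = (bᶜ + a)ᶜ + a

namespace MVAlgebra

section Basic

variable {A : Type u} [MVAlgebra A]

theorem cc (a : A) : aᶜᶜ = a := compl_compl' a

theorem add_one' (a : A) : a + (0 : A)ᶜ = (0 : A)ᶜ := add_compl_zero' a

theorem one_add' (a : A) : (0 : A)ᶜ + a = (0 : A)ᶜ := by rw [add_comm, add_one']

theorem compl_add_self (a : A) : aᶜ + a = (0 : A)ᶜ := by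
  have h := lukasiewicz ((0 : A)ᶜ) a
  rwa [cc, zero_add, add_one'] at h

/-- Truncated subtraction `a ⊖ b = ¬(¬a ⊕ b)`. -/
def ominus (a b : A) : A := (aᶜ + b)ᶜ

/-- The underlying order of an MV-algebra: `a ≤ b` iff `¬a ⊕ b = 1` (equivalently,
`a ∨ b = b`, for the join defined below). -/
instance instLE : LE A where
  le a b := aᶜ + b = (0 : A)ᶜ

theorem le_def' {a b : A} : a ≤ b ↔ aᶜ + b = (0 : A)ᶜ := Iff.rfl

theorem ominus_add_of_le {a b : A} (h : a ≤ b) : ominus b a + a = b := by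
  have h1 := lukasiewicz a b
  rw [le_def'.1 h, cc, zero_add] at h1
  exact h1.symm

theorem le_add_right' (a c : A) : a ≤ a + c := by
  rw [le_def', ← add_assoc, compl_add_self, one_add']

theorem le_add_left' (a c : A) : a ≤ c + a := by
  rw [add_comm]; exact le_add_right' a c

instance instPartialOrder : PartialOrder A where
  le_refl a := compl_add_self a
  le_trans a b c hab hbc := by
    rw [← ominus_add_of_le hbc, ← ominus_add_of_le hab, ← add_assoc]
    exact le_add_left' _ _
  le_antisymm a b hab hba := by
    have h1 := lukasiewicz a b
    rw [le_def'.1 hab, le_def'.1 hba, cc, zero_add, zero_add] at h1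
    exact h1.symm

theorem add_mono' {a b c d : A} (h : a ≤ b) (h' : c ≤ d) : a + c ≤ b + d := by
  rw [← ominus_add_of_le h, ← ominus_add_of_le h', add_add_add_comm]
  exact le_add_left' _ _

theorem compl_anti {a b : A} (h : a ≤ b) : bᶜ ≤ aᶜ := by
  rw [le_def', cc, add_comm]; exact h

theorem ominus_le_iff {a b c : A} : ominus a b ≤ c ↔ a ≤ b + c := by
  rw [le_def', le_def', ominus, cc, add_assoc]

theorem le_add_ominus (a b : A) : a ≤ b + ominus a b := ominus_le_iff.1 le_rfl

/-- The underlying lattice of an MV-algebra: `a ∨ b = ¬(¬a ⊕ b) ⊕ b` and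
`a ∧ b = ¬(¬a ∨ ¬b)`. -/
instance instLattice : Lattice A where
  sup a b := (aᶜ + b)ᶜ + b
  inf a b := ((aᶜᶜ + bᶜ)ᶜ + bᶜ)ᶜ
  le_sup_left a b := by
    rw [lukasiewicz]; exact le_add_left' _ _
  le_sup_right a b := le_add_left' _ _
  sup_le a b c hac hbc := by
    rw [← ominus_add_of_le hbc]
    exact add_mono' (compl_anti (add_mono' (compl_anti hac) le_rfl)) le_rfl
  inf_le_left a b := by
    have h := compl_anti (le_add_left' aᶜ (bᶜᶜ + aᶜ)ᶜ)
    rw [← lukasiewicz, cc a] at h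
    rwa [cc a]
  inf_le_right a b := by
    have h := compl_anti (le_add_left' bᶜ (aᶜᶜ + bᶜ)ᶜ)
    rwa [cc b] at h
  le_inf a b c hab hac := by
    rw [← cc a]
    apply compl_anti
    rw [← ominus_add_of_le (compl_anti hac)]
    exact add_mono' (compl_anti (add_mono' (compl_anti (compl_anti hab)) le_rfl)) le_rfl

end Basic

/-! ### Isomorphisms -/

/-- An isomorphism of MV-algebras: a bijection that preserves `⊕`, `0` and `¬`. -/
structure Iso (A : Type*) (B : Type*) [MVAlgebra A] [MVAlgebra B] extends A ≃+ B where
  map_compl' : ∀ a : A, toFun aᶜ = (toFun a)ᶜ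

instance {A : Type*} {B : Type*} [MVAlgebra A] [MVAlgebra B] :
    CoeFun (Iso A B) (fun _ => A → B) where
  coe e := e.toAddEquiv

/-! ### MV-ideals and quotients -/

section Ideals

variable {A : Type u} [MVAlgebra A]

/-- An MV-ideal: a submonoid for `⊕` that is a downset. -/
structure IsMVIdeal (I : Set A) : Prop where
  zero_mem : (0 : A) ∈ I
  add_mem : ∀ {a b : A}, a ∈ I → b ∈ I → a + b ∈ I
  mem_of_le : ∀ {a b : A}, b ≤ a → a ∈ I → b ∈ I

/-- A prime MV-ideal: a proper MV-ideal that contains `a ⊖ b` or `b ⊖ a`, for all `a`, `b`. -/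
structure IsPrimeMVIdeal (I : Set A) : Prop extends IsMVIdeal I where
  ne_univ : I ≠ Set.univ
  ominus_mem_or : ∀ a b : A, ominus a b ∈ I ∨ ominus b a ∈ I

theorem ominus_self (a : A) : ominus a a = 0 := by rw [ominus, compl_add_self, cc]

theorem ominus_trans_le (a b c : A) : ominus a c ≤ ominus a b + ominus b c := by
  rw [ominus_le_iff, add_left_comm, add_comm]
  exact (le_add_ominus a b).trans (add_mono' (le_add_ominus b c) le_rfl)

theorem ominus_add_le (a b c d : A) : ominus (a + c) (b + d) ≤ ominus a b + ominus c d := by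
  rw [ominus_le_iff, add_add_add_comm]
  exact add_mono' (le_add_ominus a b) (le_add_ominus c d)

theorem ominus_compl (a b : A) : ominus aᶜ bᶜ = ominus b a := by
  rw [ominus, ominus, cc, add_comm]

/-- The congruence of an MV-ideal: `a` and `b` are congruent modulo `I` iff both `a ⊖ b` and
`b ⊖ a` lie in `I`. -/
def idealSetoid (I : Set A) (hI : IsMVIdeal I) : Setoid A where
  r a b := ominus a b ∈ I ∧ ominus b a ∈ I
  iseqv :=
    { refl := fun a => by rw [ominus_self]; exact ⟨hI.zero_mem, hI.zero_mem⟩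
      symm := fun h => ⟨h.2, h.1⟩
      trans := fun {a b c} h h' =>
        ⟨hI.mem_of_le (ominus_trans_le a b c) (hI.add_mem h.1 h'.1),
          hI.mem_of_le (ominus_trans_le c b a) (hI.add_mem h'.2 h.2)⟩ }

/-- The quotient MV-algebra `A/I`. -/
def MVQuotient (I : Set A) (hI : IsMVIdeal I) : Type u := Quotient (idealSetoid I hI)

/-- The quotient map `A → A/I`. -/
def MVQuotient.mk (I : Set A) (hI : IsMVIdeal I) (a : A) : MVQuotient I hI :=
  Quotient.mk (idealSetoid I hI) a

theorem MVQuotient.mk_eq_mk {I : Set A} {hI : IsMVIdeal I} {a b : A} :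
    mk I hI a = mk I hI b ↔ ominus a b ∈ I ∧ ominus b a ∈ I :=
  Quotient.eq (r := idealSetoid I hI)

theorem MVQuotient.ind {I : Set A} {hI : IsMVIdeal I} {P : MVQuotient I hI → Prop}
    (h : ∀ a, P (mk I hI a)) (q : MVQuotient I hI) : P q :=
  Quotient.ind h q

instance MVQuotient.instAdd (I : Set A) (hI : IsMVIdeal I) : Add (MVQuotient I hI) where
  add := Quotient.map₂ (· + ·) fun a b h c d h' =>
    ⟨hI.mem_of_le (ominus_add_le a b c d) (hI.add_mem h.1 h'.1),
      hI.mem_of_le (ominus_add_le b a d c) (hI.add_mem h.2 h'.2)⟩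

instance MVQuotient.instZero (I : Set A) (hI : IsMVIdeal I) : Zero (MVQuotient I hI) where
  zero := mk I hI 0

instance MVQuotient.instAddCommMonoid (I : Set A) (hI : IsMVIdeal I) :
    AddCommMonoid (MVQuotient I hI) where
  nsmul := nsmulRec
  add_assoc := MVQuotient.ind fun a => MVQuotient.ind fun b => MVQuotient.ind fun c =>
    congrArg (mk I hI) (add_assoc a b c)
  add_comm := MVQuotient.ind fun a => MVQuotient.ind fun b =>
    congrArg (mk I hI) (add_comm a b)
  zero_add := MVQuotient.ind fun a => congrArg (mk I hI) (zero_add a)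
  add_zero := MVQuotient.ind fun a => congrArg (mk I hI) (add_zero a)

/-- The operations of `A/I` are those induced by the operations of `A`. -/
instance MVQuotient.instMVAlgebra (I : Set A) (hI : IsMVIdeal I) :
    MVAlgebra (MVQuotient I hI) where
  toAddCommMonoid := MVQuotient.instAddCommMonoid I hI
  compl := Quotient.map (fun a => aᶜ) fun a b h => by
    change ominus aᶜ bᶜ ∈ I ∧ ominus bᶜ aᶜ ∈ I
    rw [ominus_compl, ominus_compl]; exact ⟨h.2, h.1⟩
  compl_compl' := MVQuotient.ind fun a => congrArg (mk I hI) (cc a)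
  add_compl_zero' := MVQuotient.ind fun a => congrArg (mk I hI) (add_one' a)
  lukasiewicz := MVQuotient.ind fun a => MVQuotient.ind fun b =>
    congrArg (mk I hI) (lukasiewicz a b)

theorem MVQuotient.mk_add (I : Set A) (hI : IsMVIdeal I) (a b : A) :
    mk I hI (a + b) = mk I hI a + mk I hI b := rfl

theorem MVQuotient.mk_compl (I : Set A) (hI : IsMVIdeal I) (a : A) :
    mk I hI aᶜ = (mk I hI a)ᶜ := rfl

theorem MVQuotient.mk_zero (I : Set A) (hI : IsMVIdeal I) :
    mk I hI (0 : A) = 0 := rfl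

end Ideals

/-! ### The lattice spectrum `X`, the prime MV-spectrum `Y` and the co-spectral topology -/

section Spectra

variable (A : Type u) [MVAlgebra A]

/-- The set `X` of points of the dual space of the underlying lattice of `A`; a point `x` is given
by its prime lattice ideal `I_x`. -/
def LatticeSpectrum : Type u := {I : Order.Ideal A // I.IsPrime}

variable {A} in
/-- The prime lattice ideal `I_x`, as a subset of `A`. -/
def LatticeSpectrum.ideal (x : LatticeSpectrum A) : Set A := (x.1 : Set A)

/-- The co-spectral topology on `X`: the sets `{x | a ∈ I_x}`, for `a ∈ A`, are a basis of its
open sets. -/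
instance LatticeSpectrum.instTopologicalSpace : TopologicalSpace (LatticeSpectrum A) :=
  generateFrom {U | ∃ a : A, U = {x | a ∈ x.ideal}}

/-- The prime MV-spectrum `Y ⊆ X`: the points `y` whose `I_y` is a prime MV-ideal. -/
def PrimeMVSpectrum : Type u := {x : LatticeSpectrum A // IsPrimeMVIdeal x.ideal}

/-- The co-spectral topology on `Y` is the subspace topology inherited from `X`. -/
instance PrimeMVSpectrum.instTopologicalSpace : TopologicalSpace (PrimeMVSpectrum A) :=
  instTopologicalSpaceSubtype

variable {A}

/-- The prime MV-ideal `I_y`. -/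
def PrimeMVSpectrum.ideal (y : PrimeMVSpectrum A) : Set A := y.1.ideal

theorem PrimeMVSpectrum.isPrime (y : PrimeMVSpectrum A) : IsPrimeMVIdeal y.ideal := y.2

theorem PrimeMVSpectrum.isOpen_mem (a : A) : IsOpen {y : PrimeMVSpectrum A | a ∈ y.ideal} :=
  (isOpen_generateFrom_of_mem ⟨a, rfl⟩ :
    IsOpen {x : LatticeSpectrum A | a ∈ x.ideal}).preimage continuous_subtype_val

/-- Every prime MV-ideal is a prime ideal of the underlying lattice, so that `Y` consists of all
prime MV-ideals of `A`. -/
theorem IsPrimeMVIdeal.exists_point {I : Set A} (hI : IsPrimeMVIdeal I) :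
    ∃ y : PrimeMVSpectrum A, y.ideal = I := by
  have hsup : ∀ a ∈ I, ∀ b ∈ I, a ⊔ b ∈ I := fun a ha b hb =>
    hI.mem_of_le (sup_le (le_add_right' a b) (le_add_left' b a)) (hI.add_mem ha hb)
  let J : Order.Ideal A := Order.IsIdeal.toIdeal (I := I)
    ⟨fun _ _ hab ha => hI.mem_of_le hab ha, ⟨0, hI.zero_mem⟩,
      fun a ha b hb => ⟨a ⊔ b, hsup a ha b hb, le_sup_left, le_sup_right⟩⟩
  have hJ : (J : Set A) = I := rfl
  have : J.IsProper := ⟨hI.ne_univ⟩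
  have key : ∀ a b : A, ominus a b ∈ I → a ⊓ b ∈ I → a ∈ I := by
    intro a b h h'
    refine hI.mem_of_le ?_ (hI.add_mem h' h)
    have h1 : ominus a (ominus a b) ≤ a ⊓ b :=
      le_inf (ominus_le_iff.2 (le_add_left' _ _))
        (ominus_le_iff.2 ((le_add_ominus a b).trans (add_comm _ _).le))
    exact ((ominus_le_iff.1 h1).trans (add_comm _ _).le)
  have hP : J.IsPrime := Order.Ideal.IsPrime.of_mem_or_mem fun {a b} hab =>
    (hI.ominus_mem_or a b).imp (fun h => key a b h hab)
      (fun h => key b a h (by rw [inf_comm]; exact hab))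
  exact ⟨⟨⟨J, hP⟩, hI⟩, rfl⟩

end Spectra

/-! ### The étale space -/

section Etale

variable {A : Type u} [MVAlgebra A]

/-- The quotient MV-algebra `A/I_y`. -/
abbrev Fiber (y : PrimeMVSpectrum A) : Type u := MVQuotient y.ideal y.isPrime.toIsMVIdeal

/-- The quotient map `A → A/I_y`. -/
def toFiber (y : PrimeMVSpectrum A) (a : A) : Fiber y := MVQuotient.mk _ _ a

variable (A) in
/-- The étale space `E` over `Y`: the disjoint union of the MV-algebras `A/I_y`. -/
structure EtaleSpace : Type u where
  base : PrimeMVSpectrum A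
  val : Fiber base

/-- The global section `s_a : y ↦ [a] ∈ A/I_y`. -/
def canonicalSection (a : A) (y : PrimeMVSpectrum A) : EtaleSpace A := ⟨y, toFiber y a⟩

/-- The topology of `E` is generated by the sets `s_a(U)`, for `a ∈ A` and `U ⊆ Y` open. -/
instance EtaleSpace.instTopologicalSpace : TopologicalSpace (EtaleSpace A) :=
  generateFrom {V | ∃ (a : A) (U : Set (PrimeMVSpectrum A)), IsOpen U ∧
    V = canonicalSection a '' U}

/-- `F(U)`: the continuous sections of the projection `E → Y` over an open set `U`. -/
@[ext]
structure Sections (U : Opens (PrimeMVSpectrum A)) : Type u where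
  toFun : ∀ y : U, Fiber y.1
  continuous_toFun : Continuous fun y : U => (⟨y.1, toFun y⟩ : EtaleSpace A)

theorem canonicalSection_mem_image {a b : A} {y : PrimeMVSpectrum A}
    {U : Set (PrimeMVSpectrum A)} :
    canonicalSection a y ∈ canonicalSection b '' U ↔ y ∈ U ∧ toFiber y a = toFiber y b := by
  constructor
  · rintro ⟨z, hz, h⟩
    obtain rfl : z = y := congrArg EtaleSpace.base h
    refine ⟨hz, ?_⟩
    simp only [canonicalSection, EtaleSpace.mk.injEq, heq_eq_eq, true_and] at h
    exact h.symm
  · rintro ⟨hy, h⟩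
    exact ⟨y, hy, by rw [canonicalSection, canonicalSection, h]⟩

theorem continuous_canonicalSection (a : A) : Continuous (canonicalSection a) := by
  refine continuous_generateFrom_iff.2 ?_
  rintro _ ⟨b, U, hU, rfl⟩
  have : canonicalSection a ⁻¹' (canonicalSection b '' U) =
      U ∩ ({y | ominus a b ∈ y.ideal} ∩ {y | ominus b a ∈ y.ideal}) := by
    ext y
    rw [Set.mem_preimage, canonicalSection_mem_image]
    exact and_congr_right fun _ => MVQuotient.mk_eq_mk
  rw [this]
  exact hU.inter ((PrimeMVSpectrum.isOpen_mem _).inter (PrimeMVSpectrum.isOpen_mem _))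

/-- A section is continuous iff it is locally of the form `s_a`. -/
theorem continuous_section_iff {U : Opens (PrimeMVSpectrum A)} {s : ∀ y : U, Fiber y.1} :
    (Continuous fun y : U => (⟨y.1, s y⟩ : EtaleSpace A)) ↔
      ∀ y : U, ∃ a : A, ∀ᶠ z in 𝓝 y, s z = toFiber z.1 a := by
  constructor
  · intro h y
    obtain ⟨a, ha⟩ : ∃ a : A, s y = toFiber y.1 a :=
      MVQuotient.ind (P := fun q => ∃ a, q = toFiber y.1 a) (fun a => ⟨a, rfl⟩) (s y)
    refine ⟨a, ?_⟩
    have hopen : IsOpen (canonicalSection a '' Set.univ) :=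
      isOpen_generateFrom_of_mem ⟨a, _, isOpen_univ, rfl⟩
    have hmem : (⟨y.1, s y⟩ : EtaleSpace A) ∈ canonicalSection a '' Set.univ :=
      ⟨y.1, trivial, by rw [canonicalSection, ha]⟩
    filter_upwards [(hopen.preimage h).mem_nhds hmem] with z hz
    obtain ⟨w, -, hw⟩ := hz
    obtain rfl : w = z.1 := congrArg EtaleSpace.base hw
    simp only [canonicalSection, EtaleSpace.mk.injEq, heq_eq_eq, true_and] at hw
    exact hw.symm
  · intro h
    refine continuous_iff_continuousAt.2 fun y => ?_
    obtain ⟨a, ha⟩ := h y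
    have hc : ContinuousAt (fun z : U => canonicalSection a z.1) y :=
      ((continuous_canonicalSection a).comp continuous_subtype_val).continuousAt
    refine hc.congr ?_
    filter_upwards [ha] with z hz
    rw [canonicalSection, hz]

namespace Sections

variable {U V W : Opens (PrimeMVSpectrum A)}

instance instAdd (U : Opens (PrimeMVSpectrum A)) : Add (Sections U) where
  add s t := ⟨fun y => s.toFun y + t.toFun y, continuous_section_iff.2 fun y => by
    obtain ⟨a, ha⟩ := continuous_section_iff.1 s.continuous_toFun y
    obtain ⟨b, hb⟩ := continuous_section_iff.1 t.continuous_toFun y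
    refine ⟨a + b, ?_⟩
    filter_upwards [ha, hb] with z hz hz'
    rw [hz, hz']; rfl⟩

instance instZero (U : Opens (PrimeMVSpectrum A)) : Zero (Sections U) where
  zero := ⟨fun _ => 0, continuous_section_iff.2 fun _ => ⟨0, Filter.Eventually.of_forall
    fun _ => rfl⟩⟩

instance instAddCommMonoid (U : Opens (PrimeMVSpectrum A)) : AddCommMonoid (Sections U) where
  nsmul := nsmulRec
  add_assoc _ _ _ := Sections.ext (funext fun _ => add_assoc _ _ _)
  add_comm _ _ := Sections.ext (funext fun _ => add_comm _ _)
  zero_add _ := Sections.ext (funext fun _ => zero_add _)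
  add_zero _ := Sections.ext (funext fun _ => add_zero _)

/-- The sections over `U` form an MV-algebra under the pointwise operations, a subalgebra of the
product of the `A/I_y` over `y ∈ U`. -/
instance instMVAlgebra (U : Opens (PrimeMVSpectrum A)) : MVAlgebra (Sections U) where
  toAddCommMonoid := instAddCommMonoid U
  compl s := ⟨fun y => (s.toFun y)ᶜ, continuous_section_iff.2 fun y => by
    obtain ⟨a, ha⟩ := continuous_section_iff.1 s.continuous_toFun y
    refine ⟨aᶜ, ?_⟩
    filter_upwards [ha] with z hz
    rw [hz]; rfl⟩
  compl_compl' _ := Sections.ext (funext fun _ => cc _)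
  add_compl_zero' _ := Sections.ext (funext fun _ => add_one' _)
  lukasiewicz _ _ := Sections.ext (funext fun _ => lukasiewicz _ _)

theorem add_toFun (s t : Sections U) (y : U) : (s + t).toFun y = s.toFun y + t.toFun y := rfl

theorem zero_toFun (y : U) : (0 : Sections U).toFun y = 0 := rfl

theorem compl_toFun (s : Sections U) (y : U) : (sᶜ).toFun y = (s.toFun y)ᶜ := rfl

/-- Restriction of sections to a smaller open set. -/
def restrict (h : V ≤ U) : Sections U →+ Sections V where
  toFun s := ⟨fun y => s.toFun ⟨y.1, h y.2⟩,
    s.continuous_toFun.comp (continuous_subtype_val.subtype_mk fun y => h y.2)⟩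
  map_zero' := rfl
  map_add' _ _ := rfl

theorem restrict_compl (h : V ≤ U) (s : Sections U) : restrict h sᶜ = (restrict h s)ᶜ := rfl

end Sections

variable (A) in
/-- The MV-algebra of global sections of the étale space. -/
abbrev GlobalSections : Type u := Sections (⊤ : Opens (PrimeMVSpectrum A))

/-! ### Stalks -/

/-- The sections over the open neighbourhoods of `y`, indexed by reverse inclusion. -/
abbrev NhdSections (y : PrimeMVSpectrum A) (U : (OpenNhdsOf y)ᵒᵈ) : Type u :=
  Sections (OrderDual.ofDual U).toOpens

/-- The transition maps of the directed system of sections: the restriction maps. -/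
def nhdRestrict (y : PrimeMVSpectrum A) (U V : (OpenNhdsOf y)ᵒᵈ) (h : U ≤ V) :
    NhdSections y U →+ NhdSections y V :=
  Sections.restrict (show (OrderDual.ofDual V).toOpens ≤ (OrderDual.ofDual U).toOpens from h)

instance (y : PrimeMVSpectrum A) :
    DirectedSystem (NhdSections y) (nhdRestrict y · · ·) where
  map_self _ _ := rfl
  map_map _ _ _ _ _ _ := rfl

/-- The stalk at `y` of the sheaf of sections: the direct limit of the MV-algebras `F(U)`, over
the open neighbourhoods `U` of `y`. -/
abbrev Stalk (y : PrimeMVSpectrum A) : Type u :=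
  DirectLimit (NhdSections y) (nhdRestrict y)

/-- The germ at `y` of a section over an open neighbourhood `U` of `y`. -/
def germ (y : PrimeMVSpectrum A) (U : OpenNhdsOf y) (s : Sections U.toOpens) : Stalk y :=
  Quotient.mk _ ⟨OrderDual.toDual U, s⟩

/-- The stalk is an MV-algebra: `⊕` and `0` are those of the direct limit of additive monoids,
and the negation of the germ of `s` is the germ of `¬s`. -/
noncomputable instance Stalk.instMVAlgebra (y : PrimeMVSpectrum A) : MVAlgebra (Stalk y) where
  toAddCommMonoid := inferInstance
  compl := DirectLimit.map _ _ (fun _ s => sᶜ) fun _ _ h s =>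
    (Sections.restrict_compl h s).symm
  compl_compl' := DirectLimit.induction _ fun U s =>
    congrArg (germ y (OrderDual.ofDual U)) (cc s)
  add_compl_zero' := DirectLimit.induction _ fun U s => by
    have h0 := DirectLimit.zero_def (G := NhdSections y) (f := nhdRestrict y) U
    have h1 := DirectLimit.add_def (G := NhdSections y) (f := nhdRestrict y) U s 0ᶜ
    rw [h0]
    exact h1.trans (congrArg (germ y (OrderDual.ofDual U)) (add_one' s))
  lukasiewicz := DirectLimit.induction₂ _ fun U s t => by
    have h1 := DirectLimit.add_def (G := NhdSections y) (f := nhdRestrict y) U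
    refine Eq.trans (b := germ y (OrderDual.ofDual U) ((sᶜ + t)ᶜ + t)) ?_
      (Eq.trans (b := germ y (OrderDual.ofDual U) ((tᶜ + s)ᶜ + s))
        (congrArg _ (lukasiewicz s t)) ?_)
    · refine (congrArg (· + _) (congrArg (DirectLimit.map _ _ _ _) (h1 sᶜ t))).trans ?_
      exact h1 _ t
    · refine ((congrArg (· + _) (congrArg (DirectLimit.map _ _ _ _) (h1 tᶜ s))).trans ?_).symm
      exact h1 _ s

end Etale

end MVAlgebra

/-!
Two facts about prime MV-ideals carry the proof. Both come from a separation theorem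
(`IsMVIdeal.exists_isPrimeMVIdeal_disjoint`): an MV-ideal disjoint from a nonempty set closed
under `⊓` extends to a prime MV-ideal that is still disjoint from it. A maximal such ideal is prime
because `(a ⊖ b) ⊓ (b ⊖ a) = 0` and because disjointness `u ⊓ v = 0` passes to multiples.

* If `d` lies in every prime MV-ideal that contains `c`, then `d ≤ n • c` for some `n`
  (`exists_le_nsmul_of_forall_mem`). For `c = 0` this says that the prime MV-ideals meet in `{0}`,
  which makes `a ↦ s_a` injective.
* The co-spectral topology on `Y` is quasi-compact
  (`PrimeMVSpectrum.exists_finset_forall_exists_mem`).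

For surjectivity, a global section `s` agrees with `s_{a c}` on the basic open sets
`{y | c ∈ I_y}`, where `c` runs over a finite set `t` and these open sets cover `Y`. On the overlap
of two of them, which is `{y | c' + c ∈ I_y}`, the elements `a c` and `a c'` are congruent, so
`a c' ⊖ a c ≤ N • (c' + c)`, with `N` independent of the pair. Then `b = ⋁_{c ∈ t} (a c ⊖ N • c)`
satisfies `s = s_b`: wherever `c ∈ I_y`, the term of `c` is congruent to `a c`, and every other term
is at most `a c + N • c` because `a c' ≤ N • c' + (a c + N • c)`.

The local homeomorphism property holds because each `s_a` is an open embedding inverse to `p` on its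
image, and evaluation on stalks is bijective because sections are locally of the form `s_a` and
`{y | a ⊖ b ∈ I_y}` is open.
-/

namespace MVAlgebra

/-! ### Arithmetic of meets and truncated subtraction -/

section Arithmetic

variable {A : Type u} [MVAlgebra A]

instance instIsOrderedAddMonoid : IsOrderedAddMonoid A where
  add_le_add_left _ _ h _ := add_mono' h le_rfl

theorem zero_le' (a : A) : 0 ≤ a := by
  simpa using le_add_right' (0 : A) a

theorem le_one' (a : A) : a ≤ (0 : A)ᶜ := add_one' _

theorem inf_eq_ominus (a b : A) : a ⊓ bᶜ = ominus (b + a) b := by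
  change ((aᶜᶜ + bᶜᶜ)ᶜ + bᶜᶜ)ᶜ = ((b + a)ᶜ + b)ᶜ
  rw [cc, cc, add_comm a b]

theorem ominus_le_compl (a b : A) : ominus a b ≤ bᶜ :=
  compl_anti (le_add_left' b aᶜ)

/-- Addition preserves meets, being right adjoint to truncated subtraction. -/
theorem add_inf' (a b c : A) : a + b ⊓ c = (a + b) ⊓ (a + c) := by
  apply le_antisymm
  · exact le_inf (add_le_add le_rfl inf_le_left) (add_le_add le_rfl inf_le_right)
  · exact ominus_le_iff.1 (le_inf (ominus_le_iff.2 inf_le_left) (ominus_le_iff.2 inf_le_right))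

theorem ominus_inf_ominus (a b : A) : ominus a b ⊓ ominus b a = 0 := by
  set x := ominus a b ⊓ ominus b a
  set c := a ⊓ b
  -- `c + x = c` while `x ≤ cᶜ`, and `c` is cancellable on the elements below `cᶜ`.
  have ha : c + x ≤ a := by
    have h : ominus a b ≤ ominus a c :=
      ominus_le_iff.2 ((le_add_ominus a c).trans (add_le_add inf_le_right le_rfl))
    calc c + x ≤ c + ominus a c := add_le_add le_rfl (inf_le_left.trans h)
      _ = a := by rw [add_comm]; exact ominus_add_of_le inf_le_left
  have hb : c + x ≤ b := by
    have h : ominus b a ≤ ominus b c :=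
      ominus_le_iff.2 ((le_add_ominus b c).trans (add_le_add inf_le_left le_rfl))
    calc c + x ≤ c + ominus b c := add_le_add le_rfl (inf_le_right.trans h)
      _ = b := by rw [add_comm]; exact ominus_add_of_le inf_le_right
  have hx : x ≤ cᶜ :=
    (inf_le_left.trans (ominus_le_compl a b)).trans (compl_anti inf_le_right)
  refine le_antisymm ?_ (zero_le' x)
  calc x ≤ x ⊓ cᶜ := le_inf le_rfl hx
    _ = ominus (c + x) c := inf_eq_ominus x c
    _ ≤ 0 := ominus_le_iff.2 ((le_inf ha hb).trans (le_add_right' c 0))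

theorem inf_add_le (u v w : A) : u ⊓ (v + w) ≤ u ⊓ v + u ⊓ w := by
  rw [add_inf', add_comm (u ⊓ v) u, add_comm (u ⊓ v) w, add_inf', add_inf']
  refine le_inf (le_inf ?_ ?_) (le_inf ?_ ?_)
  · exact inf_le_left.trans (le_add_right' _ _)
  · exact inf_le_left.trans (le_add_right' _ _)
  · exact inf_le_left.trans (le_add_left' _ _)
  · exact inf_le_right.trans (add_comm _ _).le

theorem inf_nsmul_eq_zero {u v : A} (h : u ⊓ v = 0) (n : ℕ) : u ⊓ n • v = 0 := by
  refine le_antisymm ?_ (zero_le' _)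
  induction n with
  | zero => rw [zero_nsmul]; exact inf_le_right
  | succ n ih =>
    rw [succ_nsmul]
    refine (inf_add_le _ _ _).trans ?_
    rw [h, add_zero]
    exact ih

theorem nsmul_inf_nsmul_eq_zero {u v : A} (h : u ⊓ v = 0) (m n : ℕ) : m • u ⊓ n • v = 0 := by
  rw [inf_comm]
  refine inf_nsmul_eq_zero ?_ m
  rw [inf_comm]
  exact inf_nsmul_eq_zero h n

end Arithmetic

/-! ### Separation by prime MV-ideals -/

section Separation

variable {A : Type u} [MVAlgebra A]

theorem IsMVIdeal.nsmul_mem {I : Set A} (hI : IsMVIdeal I) {a : A} (ha : a ∈ I) (n : ℕ) :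
    n • a ∈ I := by
  induction n with
  | zero => rw [zero_nsmul]; exact hI.zero_mem
  | succ n ih => rw [succ_nsmul]; exact hI.add_mem ih ha

theorem isMVIdeal_zero : IsMVIdeal ({0} : Set A) where
  zero_mem := rfl
  add_mem := by
    rintro _ _ rfl rfl
    exact add_zero 0
  mem_of_le := by
    rintro _ b h rfl
    exact le_antisymm h (zero_le' b)

/-- The MV-ideal generated by an MV-ideal `I` and an element `u`. -/
def adjoin (I : Set A) (u : A) : Set A := {x | ∃ i ∈ I, ∃ n : ℕ, x ≤ i + n • u}

theorem IsMVIdeal.adjoin {I : Set A} (hI : IsMVIdeal I) (u : A) : IsMVIdeal (adjoin I u) where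
  zero_mem := ⟨0, hI.zero_mem, 0, zero_le' _⟩
  add_mem := by
    rintro a b ⟨i, hi, m, ha⟩ ⟨j, hj, n, hb⟩
    refine ⟨i + j, hI.add_mem hi hj, m + n, ?_⟩
    rw [add_nsmul, add_add_add_comm]
    exact add_le_add ha hb
  mem_of_le := by
    rintro a b h ⟨i, hi, n, ha⟩
    exact ⟨i, hi, n, h.trans ha⟩

theorem subset_adjoin (I : Set A) (u : A) : I ⊆ adjoin I u :=
  fun i hi => ⟨i, hi, 0, le_add_right' _ _⟩

theorem IsMVIdeal.mem_adjoin_self {I : Set A} (hI : IsMVIdeal I) (u : A) :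
    u ∈ MVAlgebra.adjoin I u :=
  ⟨0, hI.zero_mem, 1, by rw [zero_add, one_nsmul]⟩

theorem IsMVIdeal.sUnion {S : Set (Set A)} (hS : ∀ I ∈ S, IsMVIdeal I) (hc : IsChain (· ⊆ ·) S)
    (hne : S.Nonempty) : IsMVIdeal (⋃₀ S) where
  zero_mem := hne.elim fun I hI => ⟨I, hI, (hS I hI).zero_mem⟩
  add_mem := by
    rintro a b ⟨I, hI, ha⟩ ⟨J, hJ, hb⟩
    rcases hc.total hI hJ with h | h
    · exact ⟨J, hJ, (hS J hJ).add_mem (h ha) hb⟩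
    · exact ⟨I, hI, (hS I hI).add_mem ha (h hb)⟩
  mem_of_le := by
    rintro a b h ⟨I, hI, ha⟩
    exact ⟨I, hI, (hS I hI).mem_of_le h ha⟩

/-- The prime ideal theorem for MV-ideals. -/
theorem IsMVIdeal.exists_isPrimeMVIdeal_disjoint {I F : Set A} (hI : IsMVIdeal I)
    (hF : InfClosed F) (hne : F.Nonempty) (hIF : Disjoint I F) :
    ∃ J, IsPrimeMVIdeal J ∧ I ⊆ J ∧ Disjoint J F := by
  obtain ⟨J, hIJ, hJ⟩ := zorn_subset_nonempty {J : Set A | IsMVIdeal J ∧ Disjoint J F}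
    (fun S hS hc hSne => ⟨⋃₀ S, ⟨IsMVIdeal.sUnion (fun K hK => (hS hK).1) hc hSne,
      Set.disjoint_sUnion_left.2 fun K hK => (hS hK).2⟩, fun K hK => Set.subset_sUnion_of_mem hK⟩)
    I ⟨hI, hIF⟩
  have hJI := hJ.prop.1
  have hJF := hJ.prop.2
  have meets : ∀ u ∉ J, ∃ f ∈ F, f ∈ MVAlgebra.adjoin J u := by
    intro u hu
    by_contra! h
    exact hu (hJ.le_of_ge ⟨hJI.adjoin u, Set.disjoint_right.2 h⟩ (subset_adjoin J u)
      (hJI.mem_adjoin_self u))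
  refine ⟨J, ⟨hJI, ?_, fun a b => ?_⟩, hIJ, hJF⟩
  · rintro rfl
    exact hne.elim fun f hf => Set.disjoint_left.1 hJF trivial hf
  · by_contra! h
    obtain ⟨f, hf, i, hi, m, hfi⟩ := meets _ h.1
    obtain ⟨g, hg, j, hj, n, hgj⟩ := meets _ h.2
    refine Set.disjoint_left.1 hJF (hJI.mem_of_le ?_ (hJI.add_mem hi hj)) (hF hf hg)
    calc f ⊓ g ≤ (i + j + m • ominus a b) ⊓ (i + j + n • ominus b a) :=
          inf_le_inf (hfi.trans (add_le_add (le_add_right' i j) le_rfl))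
            (hgj.trans (add_le_add (le_add_left' j i) le_rfl))
      _ = i + j := by
          rw [← add_inf', nsmul_inf_nsmul_eq_zero (ominus_inf_ominus a b), add_zero]

theorem exists_le_nsmul_of_forall_mem {c d : A}
    (h : ∀ y : PrimeMVSpectrum A, c ∈ y.ideal → d ∈ y.ideal) : ∃ n : ℕ, d ≤ n • c := by
  by_contra! hd
  have hdisj : Disjoint (MVAlgebra.adjoin {0} c) {d} := by
    rw [Set.disjoint_singleton_right]
    rintro ⟨_, rfl, n, hn⟩
    rw [zero_add] at hn
    exact hd n hn
  obtain ⟨J, hJ, hcJ, hdJ⟩ := (isMVIdeal_zero.adjoin c).exists_isPrimeMVIdeal_disjoint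
    infClosed_singleton (Set.singleton_nonempty d) hdisj
  obtain ⟨y, rfl⟩ := hJ.exists_point
  exact Set.disjoint_singleton_right.1 hdJ (h y (hcJ (isMVIdeal_zero.mem_adjoin_self c)))

end Separation

/-! ### The co-spectral topology -/

namespace PrimeMVSpectrum

variable {A : Type u} [MVAlgebra A]

theorem one_notMem (y : PrimeMVSpectrum A) : (0 : A)ᶜ ∉ y.ideal := fun h =>
  y.isPrime.ne_univ (Set.eq_univ_of_forall fun a => y.isPrime.mem_of_le (le_one' a) h)

/-- The quasi-compactness of `Y`, for covers by basic open sets. -/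
theorem exists_finset_forall_exists_mem {S : Set A} (hS : S.Nonempty)
    (h : ∀ y : PrimeMVSpectrum A, ∃ c ∈ S, c ∈ y.ideal) :
    ∃ t : Finset A, t.Nonempty ∧ ↑t ⊆ S ∧ ∀ y : PrimeMVSpectrum A, ∃ c ∈ t, c ∈ y.ideal := by
  have h0 : (0 : A) ∈ infClosure S := by
    by_contra h0
    obtain ⟨J, hJ, -, hJS⟩ := isMVIdeal_zero.exists_isPrimeMVIdeal_disjoint
      infClosed_infClosure (hS.mono subset_infClosure) (Set.disjoint_singleton_left.2 h0)
    obtain ⟨y, rfl⟩ := hJ.exists_point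
    obtain ⟨c, hc, hcy⟩ := h y
    exact Set.disjoint_left.1 hJS hcy (subset_infClosure hc)
  obtain ⟨t, ht, htS, h0⟩ := h0
  refine ⟨t, ht, htS, fun y => ?_⟩
  by_contra! hy
  refine Finset.inf'_induction (p := fun a => a ∉ y.ideal) ht id
    (fun a ha b hb hab => (y.1.2.mem_or_mem hab).elim ha hb) hy ?_
  rw [h0]
  exact y.isPrime.zero_mem

theorem exists_mem_subset_of_isOpen {U : Set (PrimeMVSpectrum A)} (hU : IsOpen U)
    {y : PrimeMVSpectrum A} (hy : y ∈ U) :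
    ∃ c ∈ y.ideal, {z : PrimeMVSpectrum A | c ∈ z.ideal} ⊆ U := by
  obtain ⟨V, hV, rfl⟩ := isOpen_induced_iff.1 hU
  clear hU
  induction hV with
  | basic s hs =>
    obtain ⟨a, rfl⟩ := hs
    exact ⟨a, hy, fun _ hz => hz⟩
  | univ => exact ⟨0, y.isPrime.zero_mem, fun _ _ => trivial⟩
  | inter s t _ _ ihs iht =>
    obtain ⟨c, hc, hcs⟩ := ihs hy.1
    obtain ⟨d, hd, hdt⟩ := iht hy.2
    exact ⟨c + d, y.isPrime.add_mem hc hd, fun z hz =>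
      ⟨hcs (z.isPrime.mem_of_le (le_add_right' c d) hz),
        hdt (z.isPrime.mem_of_le (le_add_left' d c) hz)⟩⟩
  | sUnion S _ ih =>
    obtain ⟨V, hVS, hyV⟩ := hy
    obtain ⟨c, hc, hcV⟩ := ih V hVS hyV
    exact ⟨c, hc, fun z hz => ⟨V, hVS, hcV hz⟩⟩

end PrimeMVSpectrum

/-! ### The projection of the étale space -/

section Projection

variable {A : Type u} [MVAlgebra A]

theorem toFiber_eq_toFiber {y : PrimeMVSpectrum A} {a b : A} :
    toFiber y a = toFiber y b ↔ ominus a b ∈ y.ideal ∧ ominus b a ∈ y.ideal :=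
  MVQuotient.mk_eq_mk

theorem toFiber_surjective (y : PrimeMVSpectrum A) : Function.Surjective (toFiber y) :=
  MVQuotient.ind fun a => ⟨a, rfl⟩

theorem continuous_base : Continuous (EtaleSpace.base : EtaleSpace A → PrimeMVSpectrum A) := by
  refine continuous_def.2 fun U hU => ?_
  have : EtaleSpace.base ⁻¹' U = ⋃ a : A, canonicalSection a '' U := by
    ext ⟨y, q⟩
    obtain ⟨a, rfl⟩ := toFiber_surjective y q
    simp only [Set.mem_preimage, Set.mem_iUnion]
    constructor
    · exact fun hy => ⟨a, y, hy, rfl⟩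
    · rintro ⟨b, z, hz, h⟩
      rwa [← show z = y from congrArg EtaleSpace.base h]
  rw [this]
  exact isOpen_iUnion fun a => isOpen_generateFrom_of_mem ⟨a, U, hU, rfl⟩

theorem isOpenEmbedding_canonicalSection (a : A) : IsOpenEmbedding (canonicalSection a) :=
  .of_continuous_injective_isOpenMap (continuous_canonicalSection a)
    (Function.LeftInverse.injective (g := EtaleSpace.base) fun _ => rfl)
    fun U hU => isOpen_generateFrom_of_mem ⟨a, U, hU, rfl⟩

theorem isLocalHomeomorph_base :
    IsLocalHomeomorph (EtaleSpace.base : EtaleSpace A → PrimeMVSpectrum A) := by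
  refine IsLocalHomeomorph.mk _ fun ⟨y, q⟩ => ?_
  obtain ⟨a, rfl⟩ := toFiber_surjective y q
  have : Nonempty (PrimeMVSpectrum A) := ⟨y⟩
  have ha := isOpenEmbedding_canonicalSection a
  refine ⟨(ha.toOpenPartialHomeomorph _).symm, ?_, ?_⟩
  · rw [OpenPartialHomeomorph.symm_source, ha.toOpenPartialHomeomorph_target]
    exact ⟨y, rfl⟩
  · rw [OpenPartialHomeomorph.symm_source, ha.toOpenPartialHomeomorph_target]
    rintro _ ⟨z, rfl⟩
    exact ha.toOpenPartialHomeomorph_left_inv.symm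

end Projection

/-! ### Global sections -/

section GlobalSections

variable {A : Type u} [MVAlgebra A]

/-- The section `s_a` over an open set `U`. -/
def Sections.canonical (U : Opens (PrimeMVSpectrum A)) (a : A) : Sections U :=
  ⟨fun y => toFiber y.1 a, (continuous_canonicalSection a).comp continuous_subtype_val⟩

theorem Sections.canonical_top_injective :
    Function.Injective (Sections.canonical (⊤ : Opens (PrimeMVSpectrum A))) := by
  intro a b hab
  have key : ∀ y : PrimeMVSpectrum A, ominus a b ∈ y.ideal ∧ ominus b a ∈ y.ideal := fun y =>
    toFiber_eq_toFiber.1 (congrFun (congrArg Sections.toFun hab) ⟨y, trivial⟩)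
  have le_of_mem : ∀ a b : A, (∀ y : PrimeMVSpectrum A, ominus a b ∈ y.ideal) → a ≤ b := by
    intro a b h
    obtain ⟨n, hn⟩ := exists_le_nsmul_of_forall_mem (c := 0) fun y _ => h y
    rw [nsmul_zero, ominus_le_iff, add_zero] at hn
    exact hn
  exact le_antisymm (le_of_mem _ _ fun y => (key y).1) (le_of_mem _ _ fun y => (key y).2)

theorem Sections.exists_mem_forall_eq_toFiber (s : GlobalSections A) (y : PrimeMVSpectrum A) :
    ∃ c ∈ y.ideal, ∃ a : A, ∀ z : PrimeMVSpectrum A, c ∈ z.ideal →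
      s.toFun ⟨z, trivial⟩ = toFiber z a := by
  obtain ⟨a, ha⟩ := continuous_section_iff.1 s.continuous_toFun ⟨y, trivial⟩
  obtain ⟨V, hV, hVo, hyV⟩ := eventually_nhds_iff.1 ha
  have hVo' :
      IsOpen {z : PrimeMVSpectrum A | (⟨z, trivial⟩ : (⊤ : Opens (PrimeMVSpectrum A))) ∈ V} :=
    hVo.preimage (continuous_id.subtype_mk fun _ => trivial)
  obtain ⟨c, hc, hcV⟩ := PrimeMVSpectrum.exists_mem_subset_of_isOpen hVo' hyV
  exact ⟨c, hc, a, fun z hz => hV _ (hcV hz)⟩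

/-- The gluing step for two congruences: if `a' ⊖ a ≤ N • (c' + c)`, then `a' ⊖ N • c'` lies below
`a + N • c`. -/
theorem ominus_nsmul_le {a a' c c' : A} {N : ℕ} (h : ominus a' a ≤ N • (c' + c)) :
    ominus a' (N • c') ≤ a + N • c := by
  rw [ominus_le_iff, nsmul_add] at *
  rwa [add_left_comm] at h

theorem Sections.canonical_top_surjective :
    Function.Surjective (Sections.canonical (⊤ : Opens (PrimeMVSpectrum A))) := by
  intro s
  let S : Set A := {c | ∃ a : A, ∀ z : PrimeMVSpectrum A, c ∈ z.ideal →
    s.toFun ⟨z, trivial⟩ = toFiber z a}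
  -- `1` lies in no prime MV-ideal; it keeps the cover nonempty when `Y` is empty.
  have hS : S.Nonempty := ⟨(0 : A)ᶜ, 0, fun z hz => absurd hz z.one_notMem⟩
  obtain ⟨t, ht, htS, hcover⟩ := PrimeMVSpectrum.exists_finset_forall_exists_mem hS fun y =>
    let ⟨c, hc, a, ha⟩ := s.exists_mem_forall_eq_toFiber y
    ⟨c, ⟨a, ha⟩, hc⟩
  choose! a ha using fun c (hc : c ∈ t) => htS hc
  have hn : ∀ p : A × A, ∃ n : ℕ, p.1 ∈ t → p.2 ∈ t →
      ominus (a p.1) (a p.2) ≤ n • (p.1 + p.2) := by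
    rintro ⟨c', c⟩
    by_cases h : c' ∈ t ∧ c ∈ t
    · obtain ⟨n, hn⟩ := exists_le_nsmul_of_forall_mem (c := c' + c) (d := ominus (a c') (a c))
        fun y hy => (toFiber_eq_toFiber.1
          ((ha c' h.1 y (y.isPrime.mem_of_le (le_add_right' c' c) hy)).symm.trans
            (ha c h.2 y (y.isPrime.mem_of_le (le_add_left' c c') hy)))).1
      exact ⟨n, fun _ _ => hn⟩
    · exact ⟨0, fun h1 h2 => absurd ⟨h1, h2⟩ h⟩
  choose n hn using hn
  let N := (t ×ˢ t).sup n
  have hN : ∀ c' ∈ t, ∀ c ∈ t, ominus (a c') (a c) ≤ N • (c' + c) := fun c' hc' c hc =>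
    (hn (c', c) hc' hc).trans (nsmul_le_nsmul_left (zero_le' _)
      (Finset.le_sup (f := n) (Finset.mk_mem_product hc' hc)))
  let b := t.sup' ht fun c => ominus (a c) (N • c)
  refine ⟨b, Sections.ext (funext fun ⟨z, _⟩ => ?_)⟩
  obtain ⟨c, hc, hcz⟩ := hcover z
  refine Eq.trans ?_ (ha c hc z hcz).symm
  have hNc : N • c ∈ z.ideal := z.isPrime.nsmul_mem hcz N
  refine toFiber_eq_toFiber.2 ⟨z.isPrime.mem_of_le ?_ hNc, z.isPrime.mem_of_le ?_ hNc⟩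
  · exact ominus_le_iff.2 (Finset.sup'_le _ _ fun c' hc' => ominus_nsmul_le (hN c' hc' c hc))
  · have hb : ominus (a c) (N • c) ≤ b := Finset.le_sup' (fun c => ominus (a c) (N • c)) hc
    rw [ominus_le_iff, add_comm]
    exact ominus_le_iff.1 hb

variable (A) in
/-- The isomorphism `a ↦ s_a` of `A` onto the MV-algebra of global sections. -/
noncomputable def globalSectionsIso : Iso A (GlobalSections A) where
  toEquiv := Equiv.ofBijective (Sections.canonical ⊤)
    ⟨Sections.canonical_top_injective, Sections.canonical_top_surjective⟩
  map_add' _ _ := rfl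
  map_compl' _ := rfl

end GlobalSections

/-! ### Stalks and fibers -/

section Stalks

variable {A : Type u} [MVAlgebra A]

/-- Evaluation of germs at `y`. -/
def stalkEval (y : PrimeMVSpectrum A) : Stalk y → Fiber y :=
  DirectLimit.lift (nhdRestrict y) (fun U s => s.toFun ⟨y, (OrderDual.ofDual U).mem⟩)
    fun _ _ _ _ => rfl

theorem stalkEval_germ (y : PrimeMVSpectrum A) (U : OpenNhdsOf y) (s : Sections U.toOpens) :
    stalkEval y (germ y U s) = s.toFun ⟨y, U.mem⟩ := rfl

theorem stalkEval_injective (y : PrimeMVSpectrum A) : Function.Injective (stalkEval y) := by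
  refine DirectLimit.induction₂ _ fun U s t h => ?_
  change s.toFun ⟨y, (OrderDual.ofDual U).mem⟩ = t.toFun ⟨y, (OrderDual.ofDual U).mem⟩ at h
  obtain ⟨a, ha⟩ := continuous_section_iff.1 s.continuous_toFun ⟨y, (OrderDual.ofDual U).mem⟩
  obtain ⟨b, hb⟩ := continuous_section_iff.1 t.continuous_toFun ⟨y, (OrderDual.ofDual U).mem⟩
  have hab := toFiber_eq_toFiber.1 (ha.self_of_nhds.symm.trans (h.trans hb.self_of_nhds))
  have hopen : IsOpen ({z : PrimeMVSpectrum A | ominus a b ∈ z.ideal} ∩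
      {z | ominus b a ∈ z.ideal}) :=
    (PrimeMVSpectrum.isOpen_mem _).inter (PrimeMVSpectrum.isOpen_mem _)
  have hst : ∀ᶠ z in 𝓝 (⟨y, (OrderDual.ofDual U).mem⟩ : (OrderDual.ofDual U).toOpens),
      s.toFun z = t.toFun z := by
    filter_upwards [ha, hb, (hopen.preimage continuous_subtype_val).mem_nhds hab] with z hz hz' hz''
    rw [hz, hz', toFiber_eq_toFiber]
    exact hz''
  obtain ⟨V, hV, hVo, hyV⟩ := eventually_nhds_iff.1 hst
  have hVo' : IsOpen ((↑) '' V : Set (PrimeMVSpectrum A)) :=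
    (OrderDual.ofDual U).toOpens.isOpen.isOpenMap_subtype_val _ hVo
  let W : OpenNhdsOf y := ⟨⟨(↑) '' V, hVo'⟩, ⟨_, hyV, rfl⟩⟩
  have hWU : U ≤ OrderDual.toDual W := by
    change (W : OpenNhdsOf y) ≤ OrderDual.ofDual U
    rintro _ ⟨z, _, rfl⟩
    exact z.2
  refine Quotient.sound ⟨OrderDual.toDual W, hWU, hWU, Sections.ext (funext ?_)⟩
  rintro ⟨_, z, hz, rfl⟩
  exact hV z hz

theorem stalkEval_surjective (y : PrimeMVSpectrum A) : Function.Surjective (stalkEval y) := by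
  intro q
  obtain ⟨a, rfl⟩ := toFiber_surjective y q
  exact ⟨germ y ⊤ (Sections.canonical _ a), rfl⟩

/-- Evaluation at `y`, as an isomorphism of MV-algebras from the stalk at `y` onto `A/I_y`. -/
noncomputable def stalkIso (y : PrimeMVSpectrum A) : Iso (Stalk y) (Fiber y) where
  toEquiv := Equiv.ofBijective (stalkEval y) ⟨stalkEval_injective y, stalkEval_surjective y⟩
  map_add' := DirectLimit.induction₂ _ fun U s t =>
    congrArg (stalkEval y)
      (DirectLimit.add_def (G := NhdSections y) (f := nhdRestrict y) U s t)
  map_compl' := DirectLimit.induction _ fun _ _ => rfl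

theorem toFiber_le_toFiber {y : PrimeMVSpectrum A} {a b : A} (h : ominus a b ∈ y.ideal) :
    toFiber y a ≤ toFiber y b := by
  change toFiber y (aᶜ + b) = toFiber y (0 : A)ᶜ
  refine toFiber_eq_toFiber.2 ⟨?_, ?_⟩
  · rw [ominus, add_one', cc]
    exact y.isPrime.zero_mem
  · rw [ominus, cc, zero_add]
    exact h

theorem fiber_le_total (y : PrimeMVSpectrum A) (p q : Fiber y) : p ≤ q ∨ q ≤ p := by
  obtain ⟨a, rfl⟩ := toFiber_surjective y p
  obtain ⟨b, rfl⟩ := toFiber_surjective y q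
  exact (y.isPrime.ominus_mem_or a b).imp toFiber_le_toFiber toFiber_le_toFiber

end Stalks

end MVAlgebra

/-- The projection `E → Y` is étale; `A` is isomorphic to the MV-algebra of global sections via
`a ↦ s_a`; and, for each `y`, evaluation at `y` is an isomorphism of the stalk at `y` onto `A/I_y`,
which is totally ordered. -/
theorem corollary8p2 {A : Type u} [MVAlgebra A] :
    IsLocalHomeomorph
      (MVAlgebra.EtaleSpace.base : MVAlgebra.EtaleSpace A → MVAlgebra.PrimeMVSpectrum A) ∧
    (∃ e : MVAlgebra.Iso A (MVAlgebra.GlobalSections A),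
      ∀ (a : A) (y : (⊤ : TopologicalSpace.Opens (MVAlgebra.PrimeMVSpectrum A))),
        (e a).toFun y = MVAlgebra.toFiber y.1 a) ∧
    ∀ y : MVAlgebra.PrimeMVSpectrum A,
      (∃ φ : MVAlgebra.Iso (MVAlgebra.Stalk y) (MVAlgebra.Fiber y),
        ∀ (U : TopologicalSpace.OpenNhdsOf y) (s : MVAlgebra.Sections U.toOpens),
          φ (MVAlgebra.germ y U s) = s.toFun ⟨y, U.mem⟩) ∧
      ∀ p q : MVAlgebra.Fiber y, p ≤ q ∨ q ≤ p :=
  ⟨MVAlgebra.isLocalHomeomorph_base,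
    ⟨MVAlgebra.globalSectionsIso A, fun _ _ => rfl⟩,
    fun y => ⟨⟨MVAlgebra.stalkIso y, MVAlgebra.stalkEval_germ y⟩, MVAlgebra.fiber_le_total y⟩⟩
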